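/- Let $k\ge 3$ and $X_k=\{0,1,\dots,k-1\}$. **The group $H_c^{(k)}$ and its limit space.** Let $X_k^*$ be the rooted tree of finite words over $X_k$ (the root is the empty word, the children of $w$ are the words $wx$, $x\in X_k$), and let $\operatorname{Aut}X_k^*$ be the group of its automorphisms fixing the root. For $g\in\operatorname{Aut}X_k^*$ and $x\in X_k$ the section $g|_x\in \operatorname{Aut}X_k^*$ is defined by $g(xw)=g(x)\,g|_x(w)$ for all words $w$. For $l\in X_k$ and a permutation $\sigma$ of $X_k$ with $\sigma(l)=l$, let $a_{l,\sigma}\in\operatorname{Aut}X_k^*$ be the automorphism acting on $X_k$ by $\sigma$, with $a_{l,\sigma}|_l=a_{l,\sigma}$ and $a_{l,\sigma}|_i=1$ for $i\ne l$. Let $H_c^{(k)}\le\operatorname{Aut}X_k^*$ be the subgroup generated by all the $a_{l,\sigma}$. Give the space $X_k^{-\omega}$ of left-infinite sequences $\dots x_3x_2x_1$ over $X_k$ the product topology of discrete spaces. Two sequences $\dots x_2x_1$ and $\dots y_2y_1$ are asymptotically equivalent if there are $g_n\in H_c^{(k)}$ ($n\ge1$), taking only finitely many different values, such that $g_n(x_n\dots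 x_2x_1)=y_n\dots y_2y_1$ for all $n\ge1$. The limit space $\mathcal J^{(k)}$ of $H_c^{(k)}$ is the quotient of $X_k^{-\omega}$ by asymptotic equivalence, with the quotient topology. **The set $K^{(k)}$.** Let $p_0,\dots,p_{k-1}$ be the vertices of a regular simplex in $\mathbb R^{k-1}$, and for each $j$ let $q_j$ be the centroid of $\{p_m : m\ne j\}$. For $i\in X_k$ let $F_i:\mathbb R^{k-1}\to\mathbb R^{k-1}$ be the unique affine map with $F_i(p_i)=p_i$ and $F_i(p_j)=q_j$ for all $j\ne i$. **Proposition.** For every $k\ge3$ there is a unique nonempty compact set $K^{(k)}\subset\mathbb R^{k-1}$ with $\bigcup_{i\in X_k}F_i(K^{(k)})=K^{(k)}$, and $K^{(k)}$ is homeomorphic to $\mathcal J^{(k)}$. -/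

import Mathlib

/-! ### The rooted tree of words and its automorphisms -/

/-- The rooted tree of finite words over `X`. A word `x_n … x_1` is the list `[x_n, …, x_1]`
(leftmost letter first); the root is the empty word, and the children of `w` are the words `wx`. -/
def wordTree (X : Type*) : SimpleGraph (List X) :=
  SimpleGraph.fromRel fun u v => ∃ x : X, v = u ++ [x]

/-- The group of automorphisms of the rooted tree of words: the adjacency preserving
permutations that fix the root. -/
def TreeAut (X : Type*) : Subgroup (wordTree X ≃g wordTree X) where
  carrier := {g | g [] = []}
  mul_mem' := by
    intro a b (ha : a [] = []) (hb : b [] = [])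
    change a (b []) = []
    rw [hb, ha]
  one_mem' := rfl
  inv_mem' := by
    intro a (ha : a [] = [])
    change a⁻¹ [] = []
    nth_rw 1 [← ha]
    exact RelIso.inv_apply_self a []

instance (X : Type*) : CoeFun (TreeAut X) fun _ => List X → List X := ⟨fun g => ⇑g.1⟩

/-- `h` is the section of `g` at the letter `x`: `g(xw) = g(x) h(w)` for all words `w`. -/
def HasSection {X : Type*} (g : TreeAut X) (x : X) (h : TreeAut X) : Prop :=
  ∀ w : List X, g (x :: w) = g [x] ++ h w

/-! ### Hanoi automorphisms and the groups `H_c^(k)` -/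

/-- `a` is a `k`-peg Hanoi automorphism with `Q` as set of inactive pegs (and the complement of
`Q` as set of active pegs): its section at every active peg is trivial, its section at every
inactive peg is `a` itself, and its root permutation fixes every inactive peg. -/
def IsHanoiAut {k : ℕ} (a : TreeAut (Fin k)) (Q : Finset (Fin k)) : Prop :=
  (∀ i ∉ Q, HasSection a i 1) ∧ (∀ j ∈ Q, HasSection a j a) ∧ ∀ j ∈ Q, a [j] = [j]

/-- The `k`-peg Hanoi automorphisms with exactly `q` inactive pegs. -/
def hanoiAuts (k q : ℕ) : Set (TreeAut (Fin k)) :=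
  {a | ∃ Q : Finset (Fin k), Q.card = q ∧ IsHanoiAut a Q}

/-- The group `H_c^(k)`, generated by the Hanoi automorphisms with exactly one inactive peg. -/
def Hc (k : ℕ) : Subgroup (TreeAut (Fin k)) :=
  Subgroup.closure (hanoiAuts k 1)

/-! ### The limit space of a group of tree automorphisms -/

/-- A left-infinite sequence `… x_3 x_2 x_1` is the function `x : ℕ → X` with `x n = x_{n+1}`.
`finalWord x n` is the word `x_n … x_2 x_1`. -/
def finalWord {X : Type*} (x : ℕ → X) : ℕ → List X
  | 0 => []
  | n + 1 => x n :: finalWord x n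

/-- Asymptotic equivalence of left-infinite sequences with respect to the group `G`. -/
def AsympEquiv {X : Type*} (G : Subgroup (TreeAut X)) (x y : ℕ → X) : Prop :=
  ∃ g : ℕ → TreeAut X, (∀ n, g n ∈ G) ∧ (Set.range g).Finite ∧
    ∀ n, 1 ≤ n → g n (finalWord x n) = finalWord y n

theorem AsympEquiv.equivalence {X : Type*} (G : Subgroup (TreeAut X)) :
    Equivalence (AsympEquiv G) where
  refl x := ⟨fun _ => 1, fun _ => G.one_mem, Set.finite_range_const, fun _ _ => rfl⟩
  symm := by
    rintro x y ⟨g, hg, hfin, h⟩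
    refine ⟨fun n => (g n)⁻¹, fun n => G.inv_mem (hg n), ?_, fun n hn => ?_⟩
    · refine (hfin.image (fun a => a⁻¹)).subset ?_
      rintro _ ⟨n, rfl⟩
      exact ⟨g n, ⟨n, rfl⟩, rfl⟩
    · rw [← h n hn]
      exact RelIso.inv_apply_self (g n).1 _
  trans := by
    rintro x y z ⟨g, hg, hfin, h⟩ ⟨g', hg', hfin', h'⟩
    refine ⟨fun n => g' n * g n, fun n => G.mul_mem (hg' n) (hg n), ?_, fun n hn => ?_⟩
    · refine (hfin'.image2 (fun a b => a * b) hfin).subset ?_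
      rintro _ ⟨n, rfl⟩
      exact ⟨g' n, ⟨n, rfl⟩, g n, ⟨n, rfl⟩, rfl⟩
    · rw [← h' n hn, ← h n hn]
      rfl

/-- Asymptotic equivalence as a setoid on the space of left-infinite sequences. -/
def asympSetoid {X : Type*} (G : Subgroup (TreeAut X)) : Setoid (ℕ → X) :=
  ⟨AsympEquiv G, AsympEquiv.equivalence G⟩

/-- The limit space `J^(k)` of `H_c^(k)`: the quotient of the space of left-infinite sequences
over `Fin k` (product topology, discrete factors) by asymptotic equivalence, with the quotient
topology. -/
abbrev HanoiLimitSpace (k : ℕ) : Type :=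
  Quotient (asympSetoid (Hc k))

/-! ### The iterated function system -/

noncomputable section

/-- The vertices of an `n`-simplex in `ℝⁿ` form an affine basis. -/
def simplexBasis {n : ℕ} (s : Affine.Simplex ℝ (EuclideanSpace ℝ (Fin n)) n) :
    AffineBasis (Fin (n + 1)) ℝ (EuclideanSpace ℝ (Fin n)) :=
  ⟨s.points, s.independent, by
    rw [s.independent.affineSpan_eq_top_iff_card_eq_finrank_add_one]; simp⟩

/-- `faceCentroid s j` is the centroid `q_j` of the vertices of `s` other than `p_j`. -/
def faceCentroid {n : ℕ} (s : Affine.Simplex ℝ (EuclideanSpace ℝ (Fin n)) n) (j : Fin (n + 1)) :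
    EuclideanSpace ℝ (Fin n) :=
  Finset.centroid ℝ ({j}ᶜ : Finset (Fin (n + 1))) s.points

/-- The affine map `F_i` with `F_i(p_i) = p_i` and `F_i(p_j) = q_j` for `j ≠ i`, written in
barycentric coordinates with respect to the vertices `p_j` of `s`. -/
def simplexMap {n : ℕ} (s : Affine.Simplex ℝ (EuclideanSpace ℝ (Fin n)) n) (i : Fin (n + 1)) :
    EuclideanSpace ℝ (Fin n) →ᵃ[ℝ] EuclideanSpace ℝ (Fin n) :=
  (Fintype.linearCombination ℝ
    (fun j => if j = i then s.points j else faceCentroid s j)).toAffineMap.comp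
      (simplexBasis s).coords

/-- `simplexMap s i` has the prescribed values at the vertices. -/
theorem simplexMap_points {n : ℕ} (s : Affine.Simplex ℝ (EuclideanSpace ℝ (Fin n)) n)
    (i j : Fin (n + 1)) :
    simplexMap s i (s.points j) = if j = i then s.points j else faceCentroid s j := by
  have h : (simplexBasis s).coords (s.points j) = Pi.single j 1 := by
    funext m
    change (simplexBasis s).coord m (simplexBasis s j) = _
    rw [AffineBasis.coord_apply, Pi.single_apply]
  simp [simplexMap, h, Fintype.linearCombination_apply_single]

/-- `simplexMap s i` is the only affine map with these values at the vertices. -/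
theorem simplexMap_unique {n : ℕ} (s : Affine.Simplex ℝ (EuclideanSpace ℝ (Fin n)) n)
    (i : Fin (n + 1)) (F : EuclideanSpace ℝ (Fin n) →ᵃ[ℝ] EuclideanSpace ℝ (Fin n))
    (hF : ∀ j, F (s.points j) = if j = i then s.points j else faceCentroid s j) :
    F = simplexMap s i := by
  refine AffineMap.ext_on (s := Set.range (simplexBasis s)) (simplexBasis s).tot ?_
  rintro _ ⟨j, rfl⟩
  change F (s.points j) = simplexMap s i (s.points j)
  rw [hF, simplexMap_points]

/-- `K` is an attractor of the system of maps `F_i`: nonempty, compact, and equal to the union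
of its images under the `F_i`. -/
def IsAttractor {ι E : Type*} [TopologicalSpace E] (F : ι → E → E) (K : Set E) : Prop :=
  K.Nonempty ∧ IsCompact K ∧ ⋃ i, F i '' K = K

end

/-!
The sets `F_i(Δ)`, with `Δ` the simplex spanned by the `p_j`, are images of `Δ` under contractions
of ratio `(n - 1) / n`, where `n = k - 1`: in barycentric coordinates `x_m`,

* `F_i(x)_i = (1 + (n - 1) x_i) / n`,
* `F_i(x)_m = (1 - x_i - x_m) / n` for `m ≠ i`,

and for a regular simplex the Euclidean distance is proportional to the `ℓ²`-distance of these
coordinates (`lipschitzWith_simplexMap`). Hence there are a unique attractor `K` and a continuous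
coding map `π` from the sequences onto `K` with `π(x₀, x₁, …) = F_{x₀}(π(x₁, …))`
(`exists_isCodingMap`, `IsAttractor.eq`). As the space of sequences is compact, it remains to see
that `π x = π y` holds if and only if `x` and `y` are asymptotically equivalent
(`codingMap_eq_iff_asympEquiv`).

Equivalent sequences have the same code. Let `a` be a generator with inactive letter `l`. It
copies the letters `l` at the left end of a word, moves the next letter, and leaves the rest alone.
The maps `F_i` with `i ≠ l` agree at the fixed point `p_l` of `F_l`, so the compositions of the maps
along a word `w` and along `a(w)` agree at `p_l`, and therefore differ by `O(c ^ |w|)` at every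
point. Adding up these bounds, the same holds for every element of the group, uniformly for finitely
many elements (`IsHanoiAut.dist_wordMap_le`, `AsympEquiv.codingMap_eq`).

Sequences with the same code are equivalent. Cancelling the common outer maps, which are injective
because `k ≥ 3`, one may assume that `F_i(u) = F_j(v)` with `i ≠ j` and `u, v ∈ K`. Comparing
coordinates gives `u_i = u_j = 0`. But `K` meets a face of codimension two only in vertices
(`exists_codingMap_eq_points`), so `u = v = p_l` for some `l ≠ i, j`, and the only code of `p_l` is
the constant sequence `l`. So the two sequences differ at one position and are constant `l` beyond
it; the automorphism with inactive letter `l` which swaps `i` and `j` identifies them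
(`asympEquiv_of_eventually_const`).
-/

/-! ### Iterated function systems and their coding maps -/

/-- If a compact set `A` is covered by its own images under uniform contractions which map a
nonempty closed set `S` into itself, then a point of `A` at maximal distance from `S` has to be
at distance zero. -/
theorem subset_of_isCompact_of_contraction {ι E : Type*} [MetricSpace E] {F : ι → E → E}
    {c : NNReal} (hc : c < 1) (hF : ∀ i, LipschitzWith c (F i)) {A S : Set E} (hA : IsCompact A)
    (hAF : A ⊆ ⋃ i, F i '' A) (hS : IsClosed S) (hne : S.Nonempty)
    (hSF : ∀ i, ∀ z ∈ S, F i z ∈ S) : A ⊆ S := by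
  rcases A.eq_empty_or_nonempty with rfl | hA0
  · exact Set.empty_subset S
  obtain ⟨x, hx, hmax⟩ := hA.exists_isMaxOn hA0 (Metric.continuous_infDist_pt S).continuousOn
  have key : ∀ i, ∀ z, Metric.infDist (F i z) S ≤ c * Metric.infDist z S := by
    intro i z
    refine le_of_forall_pos_le_add fun ε hε => ?_
    obtain ⟨y, hy, hzy⟩ := (Metric.infDist_lt_iff hne).1 (lt_add_of_pos_right
      (Metric.infDist z S) hε)
    have h1 : Metric.infDist (F i z) S ≤ dist (F i z) (F i y) :=
      Metric.infDist_le_dist_of_mem (hSF i y hy)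
    have h2 := (hF i).dist_le_mul z y
    have hc' : (c : ℝ) ≤ 1 := by exact_mod_cast hc.le
    nlinarith [c.coe_nonneg]
  obtain ⟨i, z, hz, hzx⟩ := Set.mem_iUnion.1 (hAF hx)
  have hx0 : Metric.infDist x S = 0 := by
    have h1 : Metric.infDist x S ≤ c * Metric.infDist z S := hzx ▸ key i z
    have h2 : Metric.infDist z S ≤ Metric.infDist x S := hmax hz
    have h3 : (c : ℝ) < 1 := by exact_mod_cast hc
    nlinarith [c.coe_nonneg, Metric.infDist_nonneg (x := x) (s := S)]
  intro y hy
  have h : Metric.infDist y S ≤ Metric.infDist x S := hmax hy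
  exact (hS.mem_iff_infDist_zero hne).2 (le_antisymm (h.trans hx0.le) Metric.infDist_nonneg)

theorem IsAttractor.subset {ι E : Type*} [MetricSpace E] {F : ι → E → E}
    {c : NNReal} (hc : c < 1) (hF : ∀ i, LipschitzWith c (F i)) {K K' : Set E}
    (hK : IsAttractor F K) (hK' : IsAttractor F K') : K ⊆ K' :=
  subset_of_isCompact_of_contraction hc hF hK.2.1 hK.2.2.superset hK'.2.1.isClosed hK'.1
    fun i z hz => hK'.2.2.subset (Set.mem_iUnion.2 ⟨i, z, hz, rfl⟩)

theorem IsAttractor.eq {ι E : Type*} [MetricSpace E] {F : ι → E → E}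
    {c : NNReal} (hc : c < 1) (hF : ∀ i, LipschitzWith c (F i)) {K K' : Set E}
    (hK : IsAttractor F K) (hK' : IsAttractor F K') : K = K' :=
  (hK.subset hc hF hK').antisymm (hK'.subset hc hF hK)

/-- A continuous map `π` on sequences is a coding map of the system `F` if
`π(x₀, x₁, x₂, …) = F_{x₀}(π(x₁, x₂, …))`. In the notation for left-infinite sequences, the
rightmost letter is the index of the outermost map. -/
def IsCodingMap {ι E : Type*} (F : ι → E → E) (π : (ℕ → ι) → E) : Prop :=
  ∀ x, π x = F (x 0) (π fun n => x (n + 1))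

/-- The coding map is the fixed point of the operator `f ↦ (x ↦ F_{x₀}(f(x₁, x₂, …)))`, a
contraction of the space of continuous functions on the compact space of sequences. -/
theorem exists_isCodingMap {ι E : Type*} [Finite ι] [TopologicalSpace ι] [DiscreteTopology ι]
    [MetricSpace E] [CompleteSpace E] [Nonempty E] {F : ι → E → E} {c : NNReal} (hc : c < 1)
    (hF : ∀ i, LipschitzWith c (F i)) :
    ∃ π : (ℕ → ι) → E, Continuous π ∧ IsCodingMap F π := by
  have hcont : ∀ f : C(ℕ → ι, E),
      Continuous fun x : ℕ → ι => F (x 0) (f fun n => x (n + 1)) := by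
    intro f
    have h1 : Continuous fun p : ι × E => F p.1 p.2 :=
      continuous_prod_of_discrete_left.2 fun i => (hF i).continuous
    have h2 : Continuous fun x : ℕ → ι => f fun n => x (n + 1) :=
      f.continuous.comp (continuous_pi fun n => continuous_apply (n + 1))
    exact h1.comp ((continuous_apply 0).prodMk h2)
  let T : C(ℕ → ι, E) → C(ℕ → ι, E) := fun f => ⟨_, hcont f⟩
  have hT : ContractingWith c T := by
    refine ⟨hc, LipschitzWith.of_dist_le_mul fun f g => ?_⟩
    refine (ContinuousMap.dist_le (by positivity)).2 fun x => ?_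
    exact ((hF (x 0)).dist_le_mul _ _).trans
      (mul_le_mul_of_nonneg_left (ContinuousMap.dist_apply_le_dist _) c.coe_nonneg)
  have : Nonempty C(ℕ → ι, E) := ⟨ContinuousMap.const _ (Classical.arbitrary E)⟩
  refine ⟨hT.fixedPoint, hT.fixedPoint.continuous, fun x => ?_⟩
  conv_lhs => rw [← hT.fixedPoint_isFixedPt.eq]
  rfl

theorem IsCodingMap.isAttractor_range {ι E : Type*} [Finite ι] [Nonempty ι] [TopologicalSpace ι]
    [TopologicalSpace E] {F : ι → E → E} {π : (ℕ → ι) → E}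
    (hcont : Continuous π) (hπ : IsCodingMap F π) : IsAttractor F (Set.range π) := by
  refine ⟨Set.range_nonempty π, isCompact_range hcont, ?_⟩
  ext z
  simp only [Set.mem_iUnion, Set.mem_image, Set.mem_range]
  constructor
  · rintro ⟨i, _, ⟨x, rfl⟩, rfl⟩
    refine ⟨fun n => n.casesOn i x, ?_⟩
    rw [hπ]
    rfl
  · rintro ⟨x, rfl⟩
    exact ⟨x 0, _, ⟨_, rfl⟩, (hπ x).symm⟩

/-- The composition of the maps of the system along a word; the map of the leftmost letter is
applied first. -/
def wordMap {ι E : Type*} (F : ι → E → E) (w : List ι) (p : E) : E :=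
  w.foldl (fun q i => F i q) p

theorem wordMap_cons {ι E : Type*} (F : ι → E → E) (i : ι) (w : List ι) (p : E) :
    wordMap F (i :: w) p = wordMap F w (F i p) := rfl

theorem dist_wordMap_le {ι E : Type*} [MetricSpace E] {F : ι → E → E} {c : NNReal}
    (hF : ∀ i, LipschitzWith c (F i)) (w : List ι) (p q : E) :
    dist (wordMap F w p) (wordMap F w q) ≤ (c : ℝ) ^ w.length * dist p q := by
  induction w generalizing p q with
  | nil => simp [wordMap]
  | cons i w ih =>
    rw [wordMap_cons, wordMap_cons, List.length_cons, pow_succ, mul_assoc]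
    exact (ih _ _).trans (by gcongr; exact (hF i).dist_le_mul p q)

theorem wordMap_injective {ι E : Type*} {F : ι → E → E} (hF : ∀ i, Function.Injective (F i))
    (w : List ι) : Function.Injective (wordMap F w) := by
  induction w with
  | nil => exact fun _ _ h => h
  | cons i w ih => exact fun p q h => hF i (ih h)

theorem IsCodingMap.apply_eq_wordMap {ι E : Type*} {F : ι → E → E} {π : (ℕ → ι) → E}
    (hπ : IsCodingMap F π) (x : ℕ → ι) (n : ℕ) :
    π x = wordMap F (finalWord x n) (π fun m => x (m + n)) := by
  induction n with
  | zero => rfl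
  | succ n ih =>
    rw [ih, finalWord, wordMap_cons, hπ fun m => x (m + n)]
    simp only [zero_add, add_assoc, add_comm 1 n]

theorem finalWord_length {X : Type*} (x : ℕ → X) (n : ℕ) : (finalWord x n).length = n := by
  induction n with
  | zero => rfl
  | succ n ih => rw [finalWord, List.length_cons, ih]

theorem finalWord_congr {X : Type*} {x y : ℕ → X} {n : ℕ} (h : ∀ m < n, x m = y m) :
    finalWord x n = finalWord y n := by
  induction n with
  | zero => rfl
  | succ n ih => rw [finalWord, finalWord, h n n.lt_succ_self,
    ih fun m hm => h m (hm.trans n.lt_succ_self)]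

/-! ### Hanoi automorphisms and the coding map -/

theorem wordTree_adj_iff {X : Type*} {u v : List X} :
    (wordTree X).Adj u v ↔ (∃ x, v = u ++ [x]) ∨ ∃ x, u = v ++ [x] := by
  refine (SimpleGraph.fromRel_adj _ _ _).trans ?_
  rw [and_iff_right_iff_imp]
  rintro (⟨x, rfl⟩ | ⟨x, rfl⟩) <;> simp

theorem exists_singleton_of_treeAut {X : Type*} (a : TreeAut X) (x : X) : ∃ y, a [x] = [y] := by
  have h0 : a [] = [] := a.2
  have h : (wordTree X).Adj (a []) (a [x]) :=
    a.1.map_rel_iff.2 (wordTree_adj_iff.2 (Or.inl ⟨x, rfl⟩))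
  rw [h0, wordTree_adj_iff] at h
  rcases h with ⟨y, hy⟩ | ⟨y, hy⟩
  · exact ⟨y, hy⟩
  · simp at hy

theorem IsHanoiAut.apply_cons_self {k : ℕ} {a : TreeAut (Fin k)} {l : Fin k}
    (ha : IsHanoiAut a {l}) (w : List (Fin k)) : a (l :: w) = l :: a w := by
  have hl : l ∈ ({l} : Finset (Fin k)) := Finset.mem_singleton_self l
  rw [ha.2.1 l hl w, ha.2.2 l hl]
  rfl

theorem IsHanoiAut.exists_apply_cons {k : ℕ} {a : TreeAut (Fin k)} {l x : Fin k}
    (ha : IsHanoiAut a {l}) (hx : x ≠ l) : ∃ y ≠ l, ∀ w, a (x :: w) = y :: w := by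
  have hl : l ∈ ({l} : Finset (Fin k)) := Finset.mem_singleton_self l
  obtain ⟨y, hy⟩ := exists_singleton_of_treeAut a x
  refine ⟨y, ?_, fun w => ?_⟩
  · rintro rfl
    have h : a [x] = a [y] := hy.trans (ha.2.2 y hl).symm
    exact hx (by simpa using a.1.injective h)
  · rw [ha.1 x (by simpa using hx) w, hy]
    rfl

/-- The compositions along `w` and `a(w)` agree on the fixed point `P l` of `F l`, where `l` is
the inactive letter of `a`; so by contraction they are exponentially close everywhere. -/
theorem IsHanoiAut.dist_wordMap_le {k : ℕ} {E : Type*} [MetricSpace E] {F : Fin k → E → E}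
    {c : NNReal} (hF : ∀ i, LipschitzWith c (F i)) {P : Fin k → E} (hP : ∀ l, F l (P l) = P l)
    (hglue : ∀ l i j, i ≠ l → j ≠ l → F i (P l) = F j (P l)) {a : TreeAut (Fin k)} {l : Fin k}
    (ha : IsHanoiAut a {l}) (w : List (Fin k)) (p : E) :
    (a w).length = w.length ∧
      dist (wordMap F w p) (wordMap F (a w) p) ≤ 2 * dist p (P l) * (c : ℝ) ^ w.length := by
  induction w generalizing p with
  | nil =>
    have h0 : a [] = [] := a.2
    rw [h0, dist_self]
    exact ⟨rfl, by positivity⟩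
  | cons x w ih =>
    by_cases hx : x = l
    · subst hx
      rw [ha.apply_cons_self, wordMap_cons, wordMap_cons, List.length_cons, List.length_cons]
      refine ⟨by rw [(ih p).1], (ih (F x p)).2.trans ?_⟩
      have h := (hF x).dist_le_mul p (P x)
      rw [hP] at h
      calc 2 * dist (F x p) (P x) * (c : ℝ) ^ w.length
          ≤ 2 * (c * dist p (P x)) * (c : ℝ) ^ w.length := by gcongr
        _ = _ := by ring
    · obtain ⟨y, hy, hay⟩ := ha.exists_apply_cons hx
      rw [hay, wordMap_cons, wordMap_cons, List.length_cons, List.length_cons]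
      refine ⟨rfl, (_root_.dist_wordMap_le hF w _ _).trans ?_⟩
      have h1 := (hF x).dist_le_mul p (P l)
      have h2 := (hF y).dist_le_mul p (P l)
      rw [← hglue l x y hx hy] at h2
      have h3 := dist_triangle_right (F x p) (F y p) (F x (P l))
      calc (c : ℝ) ^ w.length * dist (F x p) (F y p)
          ≤ (c : ℝ) ^ w.length * (c * dist p (P l) + c * dist p (P l)) := by gcongr; linarith
        _ = _ := by ring

/-- Every element of the group moves the compositions along words by an exponentially small
amount: the bounds for the generators add up. -/
theorem exists_dist_wordMap_le_of_mem_Hc {k : ℕ} {E : Type*} [MetricSpace E] {F : Fin k → E → E}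
    {c : NNReal} (hF : ∀ i, LipschitzWith c (F i)) {P : Fin k → E} (hP : ∀ l, F l (P l) = P l)
    (hglue : ∀ l i j, i ≠ l → j ≠ l → F i (P l) = F j (P l)) (p : E) {g : TreeAut (Fin k)}
    (hg : g ∈ Hc k) :
    ∃ C : ℝ, ∀ w, (g w).length = w.length ∧
      dist (wordMap F w p) (wordMap F (g w) p) ≤ C * (c : ℝ) ^ w.length := by
  induction hg using Subgroup.closure_induction with
  | mem a ha =>
    obtain ⟨Q, hQ, ha⟩ := ha
    obtain ⟨l, rfl⟩ := Finset.card_eq_one.1 hQ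
    exact ⟨_, fun w => ha.dist_wordMap_le hF hP hglue w p⟩
  | one => exact ⟨0, fun w => ⟨rfl, by rw [zero_mul]; exact (dist_self _).le⟩⟩
  | mul a b _ _ iha ihb =>
    obtain ⟨A, hA⟩ := iha
    obtain ⟨B, hB⟩ := ihb
    refine ⟨B + A, fun w => ?_⟩
    have h : (a * b) w = a (b w) := rfl
    rw [h, add_mul]
    refine ⟨(hA _).1.trans (hB w).1, (dist_triangle _ _ _).trans (add_le_add (hB w).2 ?_)⟩
    exact (hB w).1 ▸ (hA (b w)).2
  | inv a _ iha =>
    obtain ⟨A, hA⟩ := iha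
    refine ⟨A, fun w => ?_⟩
    have h : a (a⁻¹ w) = w := RelIso.apply_inv_self a.1 w
    have h1 := hA (a⁻¹ w)
    rw [h] at h1
    exact ⟨h1.1.symm, by rw [dist_comm, h1.1]; exact h1.2⟩

/-- Asymptotically equivalent sequences have the same code. -/
theorem AsympEquiv.codingMap_eq {k : ℕ} {E : Type*} [MetricSpace E] {F : Fin k → E → E}
    {c : NNReal} (hc : c < 1) (hF : ∀ i, LipschitzWith c (F i)) {P : Fin k → E}
    (hP : ∀ l, F l (P l) = P l) (hglue : ∀ l i j, i ≠ l → j ≠ l → F i (P l) = F j (P l))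
    {π : (ℕ → Fin k) → E} (hcont : Continuous π) (hπ : IsCodingMap F π) {x y : ℕ → Fin k}
    (h : AsympEquiv (Hc k) x y) : π x = π y := by
  obtain ⟨g, hg, hfin, hgxy⟩ := h
  have hC : ∀ f : TreeAut (Fin k), ∃ C : ℝ, f ∈ Hc k → ∀ w, (f w).length = w.length ∧
      dist (wordMap F w (π x)) (wordMap F (f w) (π x)) ≤ C * (c : ℝ) ^ w.length := by
    intro f
    by_cases hf : f ∈ Hc k
    · obtain ⟨C, hC⟩ := exists_dist_wordMap_le_of_mem_Hc hF hP hglue (π x) hf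
      exact ⟨C, fun _ => hC⟩
    · exact ⟨0, fun h => absurd h hf⟩
  choose C hC using hC
  obtain ⟨B, hB⟩ := (hfin.image C).bddAbove
  obtain ⟨D, hD⟩ := Metric.isBounded_iff.1 (isCompact_range hcont).isBounded
  have hcode : ∀ z n, dist (π z) (wordMap F (finalWord z n) (π x)) ≤ D * (c : ℝ) ^ n := by
    intro z n
    have h1 := dist_wordMap_le hF (finalWord z n) (π fun m => z (m + n)) (π x)
    rw [← hπ.apply_eq_wordMap, finalWord_length] at h1
    have h2 : dist (π fun m => z (m + n)) (π x) ≤ D := hD ⟨_, rfl⟩ ⟨_, rfl⟩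
    refine h1.trans ?_
    rw [mul_comm]
    gcongr
  have hbound : ∀ n, 1 ≤ n → dist (π x) (π y) ≤ (D + B + D) * (c : ℝ) ^ n := by
    intro n hn
    have h1 := (hC (g n) (hg n) (finalWord x n)).2
    rw [hgxy n hn, finalWord_length] at h1
    have h2 : C (g n) * (c : ℝ) ^ n ≤ B * (c : ℝ) ^ n := by
      gcongr
      exact hB ⟨_, ⟨n, rfl⟩, rfl⟩
    have h3 := dist_triangle4_right (π x) (π y) (wordMap F (finalWord x n) (π x))
      (wordMap F (finalWord y n) (π x))
    have h4 := hcode x n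
    have h5 := hcode y n
    linarith
  have hlim : Filter.Tendsto (fun n => (D + B + D) * (c : ℝ) ^ n) Filter.atTop (nhds 0) := by
    simpa using (tendsto_pow_atTop_nhds_zero_of_lt_one c.coe_nonneg
      (by exact_mod_cast hc)).const_mul (D + B + D)
  exact dist_le_zero.1 (ge_of_tendsto hlim (Filter.eventually_atTop.2 ⟨1, hbound⟩))

/-! ### Involutions gluing two sequences -/

/-- The map on words which looks for the leftmost letter `x ≠ l` and replaces it by `σ x`. -/
def hanoiFun {X : Type*} [DecidableEq X] (l : X) (σ : X → X) : List X → List X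
  | [] => []
  | x :: w => if x = l then l :: hanoiFun l σ w else σ x :: w

theorem hanoiFun_involutive {X : Type*} [DecidableEq X] {l : X} {σ : X → X}
    (hσ : Function.Involutive σ) (hl : σ l = l) : Function.Involutive (hanoiFun l σ) := by
  intro w
  induction w with
  | nil => rfl
  | cons x w ih =>
    by_cases hx : x = l
    · simp [hanoiFun, hx, ih]
    · have : σ x ≠ l := fun h => hx (by rw [← hσ x, h, hl])
      simp [hanoiFun, hx, this, hσ x]

theorem exists_hanoiFun_append {X : Type*} [DecidableEq X] (l : X) (σ : X → X) (w : List X)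
    (x : X) : ∃ y, hanoiFun l σ (w ++ [x]) = hanoiFun l σ w ++ [y] := by
  induction w with
  | nil => by_cases hx : x = l <;> simp [hanoiFun, hx]
  | cons z w ih =>
    by_cases hz : z = l
    · simpa [hanoiFun, hz] using ih
    · simp [hanoiFun, hz]

/-- The automorphism with inactive letter `l` and root permutation the involution `σ`. -/
def hanoiAut {X : Type*} [DecidableEq X] (l : X) (σ : X → X) (hσ : Function.Involutive σ)
    (hl : σ l = l) : TreeAut X :=
  ⟨⟨(hanoiFun_involutive hσ hl).toPerm, by
    intro a b
    have h : ∀ u v, (wordTree X).Adj u v →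
        (wordTree X).Adj (hanoiFun l σ u) (hanoiFun l σ v) := by
      intro u v huv
      rw [wordTree_adj_iff] at huv ⊢
      rcases huv with ⟨x, rfl⟩ | ⟨x, rfl⟩
      · exact Or.inl (exists_hanoiFun_append l σ u x)
      · exact Or.inr (exists_hanoiFun_append l σ v x)
    refine ⟨fun huv => ?_, h _ _⟩
    have := h _ _ huv
    simpa only [Function.Involutive.coe_toPerm, hanoiFun_involutive hσ hl _] using this⟩, rfl⟩

theorem hanoiAut_mem_Hc {k : ℕ} (l : Fin k) (σ : Fin k → Fin k) (hσ : Function.Involutive σ)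
    (hl : σ l = l) : hanoiAut l σ hσ hl ∈ Hc k := by
  refine Subgroup.subset_closure ⟨{l}, Finset.card_singleton l, ?_, ?_, ?_⟩
  · intro i hi w
    have hi : i ≠ l := by simpa using hi
    change hanoiFun l σ (i :: w) = hanoiFun l σ [i] ++ w
    simp [hanoiFun, hi]
  · intro j hj w
    obtain rfl := Finset.mem_singleton.1 hj
    change hanoiFun j σ (j :: w) = hanoiFun j σ [j] ++ hanoiFun j σ w
    simp [hanoiFun]
  · intro j hj
    obtain rfl := Finset.mem_singleton.1 hj
    change hanoiFun j σ [j] = [j]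
    simp [hanoiFun]

/-- Two sequences which differ at a single position `m`, carry letters other than `l` there and
only the letter `l` at all later positions are asymptotically equivalent. -/
theorem asympEquiv_of_eventually_const {k : ℕ} {x y : ℕ → Fin k} {m : ℕ} {l : Fin k}
    (hlt : ∀ j < m, x j = y j) (hxm : x m ≠ l) (hym : y m ≠ l) (hx : ∀ j, x (j + (m + 1)) = l)
    (hy : ∀ j, y (j + (m + 1)) = l) : AsympEquiv (Hc k) x y := by
  have hl : Equiv.swap (x m) (y m) l = l := Equiv.swap_apply_of_ne_of_ne hxm.symm hym.symm
  have hσ : Function.Involutive (Equiv.swap (x m) (y m)) := Equiv.swap_apply_self _ _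
  set a := hanoiAut l _ hσ hl with ha
  refine ⟨fun n => if n ≤ m then 1 else a, fun n => ?_, ?_, fun n _ => ?_⟩
  · dsimp only
    split_ifs
    exacts [(Hc k).one_mem, hanoiAut_mem_Hc l _ hσ hl]
  · refine (Set.toFinite {1, a}).subset ?_
    rintro _ ⟨n, rfl⟩
    dsimp only
    split_ifs <;> simp
  · dsimp only
    split_ifs with hn
    · exact finalWord_congr fun j hj => hlt j (hj.trans_le hn)
    · obtain ⟨d, rfl⟩ : ∃ d, n = d + (m + 1) := ⟨n - (m + 1), by omega⟩
      clear hn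
      change hanoiFun l _ _ = _
      induction d with
      | zero =>
        rw [zero_add, finalWord, finalWord, hanoiFun, if_neg hxm, Equiv.swap_apply_left,
          finalWord_congr hlt]
      | succ d ih =>
        rw [add_right_comm, finalWord, finalWord, hanoiFun, if_pos (hx d), hy d, ih (by omega)]

/-! ### The system in barycentric coordinates -/

theorem simplexBasis_apply {n : ℕ} (s : Affine.Simplex ℝ (EuclideanSpace ℝ (Fin n)) n)
    (j : Fin (n + 1)) : simplexBasis s j = s.points j := rfl

theorem coord_points {n : ℕ} (s : Affine.Simplex ℝ (EuclideanSpace ℝ (Fin n)) n)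
    (m j : Fin (n + 1)) : (simplexBasis s).coord m (s.points j) = if m = j then 1 else 0 := by
  rw [← simplexBasis_apply, AffineBasis.coord_apply]

theorem coord_faceCentroid {n : ℕ} (hn : n ≠ 0)
    (s : Affine.Simplex ℝ (EuclideanSpace ℝ (Fin n)) n) (m j : Fin (n + 1)) :
    (simplexBasis s).coord m (faceCentroid s j) = if m = j then 0 else (n : ℝ)⁻¹ := by
  have hcard : ({j}ᶜ : Finset (Fin (n + 1))).card = n := by
    simp [Finset.card_compl]
  have hb : s.points = simplexBasis s := rfl
  rw [faceCentroid, hb]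
  split_ifs with h
  · refine AffineBasis.coord_apply_combination_of_notMem _ (by simp [h]) ?_
    exact Finset.sum_centroidWeights_eq_one_of_card_ne_zero ℝ _ (by rw [hcard]; exact hn)
  · rw [AffineBasis.coord_apply_centroid _ (by simpa using h), hcard]

theorem coord_simplexMap_self {n : ℕ} (hn : n ≠ 0)
    (s : Affine.Simplex ℝ (EuclideanSpace ℝ (Fin n)) n) (i : Fin (n + 1))
    (x : EuclideanSpace ℝ (Fin n)) :
    (simplexBasis s).coord i (simplexMap s i x) =
      (1 + (n - 1) * (simplexBasis s).coord i x) / n := by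
  have hn' : (n : ℝ) ≠ 0 := by exact_mod_cast hn
  let G : EuclideanSpace ℝ (Fin n) →ᵃ[ℝ] ℝ :=
    (n : ℝ)⁻¹ • (AffineMap.const ℝ _ 1 + ((n : ℝ) - 1) • (simplexBasis s).coord i)
  have h : ((simplexBasis s).coord i).comp (simplexMap s i) = G := by
    refine AffineMap.ext_on (s := Set.range (simplexBasis s)) (simplexBasis s).tot ?_
    rintro _ ⟨j, rfl⟩
    change (simplexBasis s).coord i (simplexMap s i (s.points j)) =
      (n : ℝ)⁻¹ * (1 + ((n : ℝ) - 1) * (simplexBasis s).coord i (s.points j))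
    rw [simplexMap_points]
    by_cases hj : j = i
    · rw [if_pos hj, coord_points, if_pos hj.symm]
      field_simp
      ring
    · rw [if_neg hj, coord_points, if_neg (Ne.symm hj), coord_faceCentroid hn,
        if_neg (Ne.symm hj)]
      ring
  calc _ = G x := congrArg (fun f => f x) h
    _ = (n : ℝ)⁻¹ * (1 + ((n : ℝ) - 1) * (simplexBasis s).coord i x) := rfl
    _ = _ := by ring

theorem coord_simplexMap_of_ne {n : ℕ} (hn : n ≠ 0)
    (s : Affine.Simplex ℝ (EuclideanSpace ℝ (Fin n)) n) {i m : Fin (n + 1)} (hm : m ≠ i)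
    (x : EuclideanSpace ℝ (Fin n)) :
    (simplexBasis s).coord m (simplexMap s i x) =
      (1 - (simplexBasis s).coord i x - (simplexBasis s).coord m x) / n := by
  let G : EuclideanSpace ℝ (Fin n) →ᵃ[ℝ] ℝ :=
    (n : ℝ)⁻¹ • (AffineMap.const ℝ _ 1 - (simplexBasis s).coord i - (simplexBasis s).coord m)
  have h : ((simplexBasis s).coord m).comp (simplexMap s i) = G := by
    refine AffineMap.ext_on (s := Set.range (simplexBasis s)) (simplexBasis s).tot ?_
    rintro _ ⟨j, rfl⟩
    change (simplexBasis s).coord m (simplexMap s i (s.points j)) =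
      (n : ℝ)⁻¹ * (1 - (simplexBasis s).coord i (s.points j)
        - (simplexBasis s).coord m (s.points j))
    rw [simplexMap_points]
    by_cases hj : j = i
    · subst hj
      rw [if_pos rfl, coord_points, coord_points, if_pos rfl, if_neg hm]
      ring
    · rw [if_neg hj, coord_points, coord_points, if_neg (Ne.symm hj), coord_faceCentroid hn]
      split_ifs <;> ring
  calc _ = G x := congrArg (fun f => f x) h
    _ = (n : ℝ)⁻¹ * (1 - (simplexBasis s).coord i x - (simplexBasis s).coord m x) := rfl
    _ = _ := by ring

theorem simplexMap_injective {n : ℕ} (hn : 2 ≤ n)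
    (s : Affine.Simplex ℝ (EuclideanSpace ℝ (Fin n)) n) (i : Fin (n + 1)) :
    Function.Injective (simplexMap s i) := by
  have hn0 : n ≠ 0 := by omega
  have hn' : (2 : ℝ) ≤ n := by exact_mod_cast hn
  intro x y hxy
  have hi : (simplexBasis s).coord i x = (simplexBasis s).coord i y := by
    have h := congrArg ((simplexBasis s).coord i) hxy
    rw [coord_simplexMap_self hn0, coord_simplexMap_self hn0, div_left_inj' (by positivity)] at h
    exact mul_left_cancel₀ (by linarith : (n : ℝ) - 1 ≠ 0) (add_left_cancel h)
  refine (simplexBasis s).ext_elem fun m => ?_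
  by_cases hm : m = i
  · rw [hm, hi]
  · have h := congrArg ((simplexBasis s).coord m) hxy
    rw [coord_simplexMap_of_ne hn0 s hm, coord_simplexMap_of_ne hn0 s hm,
      div_left_inj' (by positivity)] at h
    linarith

/-- For a regular simplex the Euclidean distance is proportional to the `ℓ²`-distance of
barycentric coordinate vectors. -/
theorem exists_dist_sq_eq_mul_sum_coord {n : ℕ}
    {s : Affine.Simplex ℝ (EuclideanSpace ℝ (Fin n)) n} (hs : s.Regular) :
    ∃ r : ℝ, 0 ≤ r ∧ ∀ x y, dist x y ^ 2 =
      r * ∑ m, ((simplexBasis s).coord m x - (simplexBasis s).coord m y) ^ 2 := by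
  obtain ⟨d, hd⟩ := hs.equilateral
  refine ⟨d ^ 2 / 2, by positivity, fun x y => ?_⟩
  set b := simplexBasis s
  have h := EuclideanGeometry.dist_affineCombination (s := Finset.univ)
    (w₁ := fun m => b.coord m x) (w₂ := fun m => b.coord m y) b
    (b.sum_coord_apply_eq_one x) (b.sum_coord_apply_eq_one y)
  simp only [AffineBasis.affineCombination_coord_eq_self] at h
  rw [sq, h]
  have hdist : ∀ i j, dist (b i) (b j) * dist (b i) (b j) = d ^ 2 - if i = j then d ^ 2 else 0 := by
    intro i j
    by_cases hij : i = j
    · simp [hij]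
    · rw [if_neg hij, sub_zero, sq, ← hd i j hij]
      rfl
  have h0 : ∑ m, (b.coord m x - b.coord m y) = 0 := by
    rw [Finset.sum_sub_distrib, b.sum_coord_apply_eq_one, b.sum_coord_apply_eq_one, sub_self]
  have hsum : ∀ v : Fin (n + 1) → ℝ, ∑ m, v m = 0 →
      (-∑ i, ∑ j, v i * v j * (d ^ 2 - if i = j then d ^ 2 else 0)) / 2 =
        d ^ 2 / 2 * ∑ m, v m ^ 2 := by
    intro v hv
    have hrow : ∀ i, ∑ j, v i * v j * (d ^ 2 - if i = j then d ^ 2 else 0) =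
        -(d ^ 2 * v i ^ 2) := by
      intro i
      simp only [mul_sub, mul_ite, mul_zero, Finset.sum_sub_distrib, Finset.sum_ite_eq,
        Finset.mem_univ, if_true, ← Finset.sum_mul, ← Finset.mul_sum, hv]
      ring
    simp only [hrow, Finset.sum_neg_distrib, ← Finset.mul_sum]
    ring
  simp only [hdist]
  exact hsum _ h0

/-- The linear part of `F_i` acts on coordinate vectors of sum zero as multiplication by
`(n - 1) / n` in the direction from the face opposite `p_i` to `p_i`, and by `-1 / n` in the
directions of that face. -/
theorem lipschitzWith_simplexMap {n : ℕ} (hn : 2 ≤ n)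
    {s : Affine.Simplex ℝ (EuclideanSpace ℝ (Fin n)) n} (hs : s.Regular) (i : Fin (n + 1)) :
    LipschitzWith (((n - 1 : ℕ) : NNReal) / n) (simplexMap s i) := by
  have hn0 : n ≠ 0 := by omega
  have hn' : (2 : ℝ) ≤ n := by exact_mod_cast hn
  obtain ⟨r, hr, hdist⟩ := exists_dist_sq_eq_mul_sum_coord hs
  refine LipschitzWith.of_dist_le_mul fun x y => ?_
  rw [NNReal.coe_div, NNReal.coe_natCast, NNReal.coe_natCast, Nat.cast_sub (by omega),
    Nat.cast_one]
  refine le_of_sq_le_sq ?_ (by have : (0 : ℝ) ≤ n - 1 := by linarith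
                               positivity)
  rw [mul_pow, hdist, hdist, mul_left_comm]
  refine mul_le_mul_of_nonneg_left ?_ hr
  set v : Fin (n + 1) → ℝ := fun m => (simplexBasis s).coord m x - (simplexBasis s).coord m y
    with hv
  have hsum : v i + ∑ m ∈ Finset.univ.erase i, v m = 0 := by
    rw [Finset.add_sum_erase _ _ (Finset.mem_univ i), hv, Finset.sum_sub_distrib,
      AffineBasis.sum_coord_apply_eq_one, AffineBasis.sum_coord_apply_eq_one, sub_self]
  have hcard : (Finset.univ.erase i).card = n := by simp
  have hi : (simplexBasis s).coord i (simplexMap s i x) -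
      (simplexBasis s).coord i (simplexMap s i y) = (n - 1) / n * v i := by
    rw [coord_simplexMap_self hn0, coord_simplexMap_self hn0, hv]
    ring
  have hm : ∀ m ∈ Finset.univ.erase i, ((simplexBasis s).coord m (simplexMap s i x) -
      (simplexBasis s).coord m (simplexMap s i y)) ^ 2 = (v i + v m) ^ 2 / n ^ 2 := by
    intro m hm
    have hm := Finset.ne_of_mem_erase hm
    rw [coord_simplexMap_of_ne hn0 s hm, coord_simplexMap_of_ne hn0 s hm, hv]
    ring
  have hcs := sq_sum_le_card_mul_sum_sq (s := Finset.univ.erase i) (f := v)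
  rw [hcard, eq_neg_of_add_eq_zero_right hsum] at hcs
  change _ ≤ _ * ∑ m, v m ^ 2
  rw [← Finset.add_sum_erase _ _ (Finset.mem_univ i),
    ← Finset.add_sum_erase _ (fun m => v m ^ 2) (Finset.mem_univ i), hi,
    Finset.sum_congr rfl hm, ← Finset.sum_div]
  have hexp : ∑ m ∈ Finset.univ.erase i, (v i + v m) ^ 2 =
      (n - 2) * v i ^ 2 + ∑ m ∈ Finset.univ.erase i, v m ^ 2 := by
    simp only [add_sq, Finset.sum_add_distrib, ← Finset.mul_sum, Finset.sum_const, hcard,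
      nsmul_eq_mul]
    rw [eq_neg_of_add_eq_zero_right hsum]
    ring
  rw [hexp]
  set S := ∑ m ∈ Finset.univ.erase i, v m ^ 2
  rw [mul_pow, div_pow, div_mul_eq_mul_div, div_mul_eq_mul_div, ← add_div]
  refine div_le_div_of_nonneg_right ?_ (by positivity)
  -- The difference of the two sides is `(n - 2) * (n * S - v i ^ 2)`.
  nlinarith [mul_nonneg (sub_nonneg.2 hn') (sub_nonneg.2 hcs)]

theorem natCast_sub_one_div_lt_one {n : ℕ} (hn : 2 ≤ n) : ((n - 1 : ℕ) : NNReal) / n < 1 := by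
  rw [div_lt_one (by exact_mod_cast (by omega : 0 < n))]
  exact_mod_cast (by omega : n - 1 < n)

/-! ### Overlaps of the pieces of the attractor -/

theorem simplexMap_points_self {n : ℕ} (s : Affine.Simplex ℝ (EuclideanSpace ℝ (Fin n)) n)
    (l : Fin (n + 1)) : simplexMap s l (s.points l) = s.points l := by
  rw [simplexMap_points, if_pos rfl]

theorem simplexMap_points_eq {n : ℕ} (s : Affine.Simplex ℝ (EuclideanSpace ℝ (Fin n)) n)
    (l i j : Fin (n + 1)) (hi : i ≠ l) (hj : j ≠ l) :
    simplexMap s i (s.points l) = simplexMap s j (s.points l) := by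
  rw [simplexMap_points, simplexMap_points, if_neg hi.symm, if_neg hj.symm]

theorem coord_add_le_one_of_nonneg {n : ℕ} {s : Affine.Simplex ℝ (EuclideanSpace ℝ (Fin n)) n}
    {x : EuclideanSpace ℝ (Fin n)} (hx : ∀ m, 0 ≤ (simplexBasis s).coord m x)
    {i j : Fin (n + 1)} (hij : i ≠ j) :
    (simplexBasis s).coord i x + (simplexBasis s).coord j x ≤ 1 := by
  rw [← (simplexBasis s).sum_coord_apply_eq_one x,
    ← Finset.sum_pair (f := fun m => (simplexBasis s).coord m x) hij]
  exact Finset.sum_le_sum_of_subset_of_nonneg (Finset.subset_univ _) fun m _ _ => hx m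

theorem coord_add_add_le_one_of_nonneg {n : ℕ}
    {s : Affine.Simplex ℝ (EuclideanSpace ℝ (Fin n)) n}
    {x : EuclideanSpace ℝ (Fin n)} (hx : ∀ m, 0 ≤ (simplexBasis s).coord m x)
    {i j l : Fin (n + 1)} (hij : i ≠ j) (hil : i ≠ l) (hjl : j ≠ l) :
    (simplexBasis s).coord i x + ((simplexBasis s).coord j x + (simplexBasis s).coord l x) ≤ 1 := by
  rw [← (simplexBasis s).sum_coord_apply_eq_one x,
    ← Finset.sum_pair (f := fun m => (simplexBasis s).coord m x) hjl,
    ← Finset.sum_insert (f := fun m => (simplexBasis s).coord m x) (by simp [hij, hil])]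
  exact Finset.sum_le_sum_of_subset_of_nonneg (Finset.subset_univ _) fun m _ _ => hx m

theorem coord_simplexMap_nonneg {n : ℕ} (hn : 2 ≤ n)
    {s : Affine.Simplex ℝ (EuclideanSpace ℝ (Fin n)) n} {x : EuclideanSpace ℝ (Fin n)}
    (hx : ∀ m, 0 ≤ (simplexBasis s).coord m x) (i m : Fin (n + 1)) :
    0 ≤ (simplexBasis s).coord m (simplexMap s i x) := by
  have hn0 : n ≠ 0 := by omega
  have hn' : (2 : ℝ) ≤ n := by exact_mod_cast hn
  by_cases hm : m = i
  · rw [hm, coord_simplexMap_self hn0]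
    have := mul_nonneg (by linarith : (0 : ℝ) ≤ n - 1) (hx i)
    positivity
  · rw [coord_simplexMap_of_ne hn0 s hm]
    have := coord_add_le_one_of_nonneg hx hm
    exact div_nonneg (by linarith) (by positivity)

/-- In its own piece the coordinate with index `i` is at least `1 / n`. -/
theorem coord_simplexMap_self_pos {n : ℕ} (hn : 2 ≤ n)
    {s : Affine.Simplex ℝ (EuclideanSpace ℝ (Fin n)) n} {x : EuclideanSpace ℝ (Fin n)}
    (hx : ∀ m, 0 ≤ (simplexBasis s).coord m x) (i : Fin (n + 1)) :
    0 < (simplexBasis s).coord i (simplexMap s i x) := by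
  have hn' : (2 : ℝ) ≤ n := by exact_mod_cast hn
  rw [coord_simplexMap_self (by omega)]
  have := mul_nonneg (by linarith : (0 : ℝ) ≤ n - 1) (hx i)
  positivity

theorem eq_points_of_coord_eq_one {n : ℕ} {s : Affine.Simplex ℝ (EuclideanSpace ℝ (Fin n)) n}
    {x : EuclideanSpace ℝ (Fin n)} (hx : ∀ m, 0 ≤ (simplexBasis s).coord m x)
    {l : Fin (n + 1)} (hl : (simplexBasis s).coord l x = 1) : x = s.points l := by
  refine (simplexBasis s).ext_elem fun m => ?_
  rw [coord_points]
  split_ifs with hm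
  · rw [hm, hl]
  · have := coord_add_le_one_of_nonneg hx hm
    linarith [hx m]

/-- Points of the attractor have nonnegative barycentric coordinates. -/
theorem coord_codingMap_nonneg {n : ℕ} (hn : 2 ≤ n)
    {s : Affine.Simplex ℝ (EuclideanSpace ℝ (Fin n)) n} (hs : s.Regular)
    {π : (ℕ → Fin (n + 1)) → EuclideanSpace ℝ (Fin n)} (hcont : Continuous π)
    (hπ : IsCodingMap (fun i => ⇑(simplexMap s i)) π) (x : ℕ → Fin (n + 1)) (m : Fin (n + 1)) :
    0 ≤ (simplexBasis s).coord m (π x) := by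
  have hK := hπ.isAttractor_range hcont
  have hclosed : IsClosed {z | ∀ m, 0 ≤ (simplexBasis s).coord m z} := by
    rw [Set.ofPred_forall]
    exact isClosed_iInter fun m => isClosed_le continuous_const
      ((simplexBasis s).coord m).continuous_of_finiteDimensional
  have h := subset_of_isCompact_of_contraction (natCast_sub_one_div_lt_one hn)
    (lipschitzWith_simplexMap hn hs) hK.2.1 hK.2.2.superset hclosed
    ⟨s.points 0, fun m => by rw [coord_points]; split_ifs <;> simp⟩
    fun i z hz m => coord_simplexMap_nonneg hn hz i m
  exact h ⟨x, rfl⟩ m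

/-- The attractor meets a face of codimension two of the simplex only in vertices. -/
theorem exists_codingMap_eq_points {n : ℕ} (hn : 2 ≤ n)
    {s : Affine.Simplex ℝ (EuclideanSpace ℝ (Fin n)) n}
    {π : (ℕ → Fin (n + 1)) → EuclideanSpace ℝ (Fin n)}
    (hπ : IsCodingMap (fun i => ⇑(simplexMap s i)) π)
    (hnn : ∀ x m, 0 ≤ (simplexBasis s).coord m (π x)) {x : ℕ → Fin (n + 1)} {i j : Fin (n + 1)}
    (hij : i ≠ j) (hi : (simplexBasis s).coord i (π x) = 0)
    (hj : (simplexBasis s).coord j (π x) = 0) :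
    ∃ l, l ≠ i ∧ l ≠ j ∧ π x = s.points l := by
  have hn0 : n ≠ 0 := by omega
  have hn' : (n : ℝ) ≠ 0 := by exact_mod_cast hn0
  rw [hπ x] at hi hj
  set u := π fun m => x (m + 1)
  have hu : ∀ m, 0 ≤ (simplexBasis s).coord m u := hnn _
  have hxi : i ≠ x 0 := by
    rintro rfl
    exact (coord_simplexMap_self_pos hn hu _).ne' hi
  have hxj : j ≠ x 0 := by
    rintro rfl
    exact (coord_simplexMap_self_pos hn hu _).ne' hj
  refine ⟨x 0, hxi.symm, hxj.symm, ?_⟩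
  rw [coord_simplexMap_of_ne hn0 s hxi, div_eq_zero_iff, or_iff_left hn'] at hi
  rw [coord_simplexMap_of_ne hn0 s hxj, div_eq_zero_iff, or_iff_left hn'] at hj
  have h3 := coord_add_add_le_one_of_nonneg hu hij hxi hxj
  rw [hπ x]
  change simplexMap s (x 0) u = _
  rw [eq_points_of_coord_eq_one hu (l := x 0) (by linarith [hu i, hu j]), simplexMap_points_self]

/-- The only code of the vertex `p_l` is the constant sequence `l`. -/
theorem eq_const_of_codingMap_eq_points {n : ℕ} (hn : 2 ≤ n)
    {s : Affine.Simplex ℝ (EuclideanSpace ℝ (Fin n)) n}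
    {π : (ℕ → Fin (n + 1)) → EuclideanSpace ℝ (Fin n)}
    (hπ : IsCodingMap (fun i => ⇑(simplexMap s i)) π)
    (hnn : ∀ x m, 0 ≤ (simplexBasis s).coord m (π x)) {l : Fin (n + 1)} (m : ℕ)
    {x : ℕ → Fin (n + 1)} (hx : π x = s.points l) : x m = l := by
  have h0 : ∀ y, π y = s.points l → y 0 = l := by
    intro y hy
    by_contra h
    have h1 := coord_simplexMap_self_pos hn (hnn fun m => y (m + 1)) (y 0)
    rw [hπ y] at hy
    change simplexMap s (y 0) _ = _ at hy
    rw [hy, coord_points, if_neg h] at h1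
    exact h1.false
  induction m generalizing x with
  | zero => exact h0 x hx
  | succ m ih =>
    refine ih (x := fun m => x (m + 1)) (simplexMap_injective hn s l ?_)
    rw [simplexMap_points_self, ← hx, hπ x, h0 x hx]

/-- Two different pieces `F_i(K)` and `F_j(K)` meet only in common images of vertices `p_l`
with `l ≠ i, j`. -/
theorem exists_eq_points_of_simplexMap_eq {n : ℕ} (hn : 2 ≤ n)
    {s : Affine.Simplex ℝ (EuclideanSpace ℝ (Fin n)) n}
    {π : (ℕ → Fin (n + 1)) → EuclideanSpace ℝ (Fin n)}
    (hπ : IsCodingMap (fun i => ⇑(simplexMap s i)) π)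
    (hnn : ∀ x m, 0 ≤ (simplexBasis s).coord m (π x)) {x y : ℕ → Fin (n + 1)}
    {i j : Fin (n + 1)} (hij : i ≠ j) (h : simplexMap s i (π x) = simplexMap s j (π y)) :
    ∃ l, i ≠ l ∧ j ≠ l ∧ π x = s.points l ∧ π y = s.points l := by
  have hn0 : n ≠ 0 := by omega
  have hn' : (2 : ℝ) ≤ n := by exact_mod_cast hn
  have hn'' : (n : ℝ) ≠ 0 := by exact_mod_cast hn0
  -- Comparing the coordinates with index `i` gives `(n - 1) * u_i = - v_i - v_j`, so all three
  -- vanish, and symmetrically for `j`.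
  have key : ∀ {a b : Fin (n + 1)} {u v : EuclideanSpace ℝ (Fin n)}, a ≠ b →
      (∀ m, 0 ≤ (simplexBasis s).coord m u) → (∀ m, 0 ≤ (simplexBasis s).coord m v) →
      simplexMap s a u = simplexMap s b v → (simplexBasis s).coord a u = 0 := by
    intro a b u v hab hu hv huv
    have h1 := congrArg ((simplexBasis s).coord a) huv
    rw [coord_simplexMap_self hn0, coord_simplexMap_of_ne hn0 s hab, div_left_inj' hn''] at h1
    nlinarith [hu a, hv a, hv b]
  have hui := key hij (hnn x) (hnn y) h
  have hvj := key hij.symm (hnn y) (hnn x) h.symm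
  have huj : (simplexBasis s).coord j (π x) = 0 := by
    have h1 := congrArg ((simplexBasis s).coord j) h
    rw [coord_simplexMap_self hn0, coord_simplexMap_of_ne hn0 s hij.symm, div_left_inj' hn'',
      hui, hvj] at h1
    linarith
  obtain ⟨l, hli, hlj, hl⟩ := exists_codingMap_eq_points hn hπ hnn hij hui huj
  refine ⟨l, hli.symm, hlj.symm, hl, eq_points_of_coord_eq_one (hnn y) ?_⟩
  have h1 := congrArg ((simplexBasis s).coord l) h
  rw [coord_simplexMap_of_ne hn0 s hli, coord_simplexMap_of_ne hn0 s hlj, div_left_inj' hn'',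
    hui, hvj, hl, coord_points, if_pos rfl] at h1
  linarith

theorem codingMap_eq_iff_asympEquiv {n : ℕ} (hn : 2 ≤ n)
    {s : Affine.Simplex ℝ (EuclideanSpace ℝ (Fin n)) n} (hs : s.Regular)
    {π : (ℕ → Fin (n + 1)) → EuclideanSpace ℝ (Fin n)} (hcont : Continuous π)
    (hπ : IsCodingMap (fun i => ⇑(simplexMap s i)) π) (x y : ℕ → Fin (n + 1)) :
    π x = π y ↔ AsympEquiv (Hc (n + 1)) x y := by
  classical
  refine ⟨fun h => ?_, fun h => h.codingMap_eq (natCast_sub_one_div_lt_one hn)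
    (lipschitzWith_simplexMap hn hs) (simplexMap_points_self s) (simplexMap_points_eq s) hcont hπ⟩
  by_cases hxy : x = y
  · exact hxy ▸ (AsympEquiv.equivalence _).refl x
  have hne : ∃ m, x m ≠ y m := Function.ne_iff.1 hxy
  have hlt : ∀ j < Nat.find hne, x j = y j := fun j hj => not_not.1 (Nat.find_min hne hj)
  have hm := Nat.find_spec hne
  set m := Nat.find hne
  have hnn := coord_codingMap_nonneg hn hs hcont hπ
  rw [hπ.apply_eq_wordMap x m, hπ.apply_eq_wordMap y m, finalWord_congr hlt] at h
  have h := wordMap_injective (fun i => simplexMap_injective hn s i) _ h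
  rw [hπ, hπ fun j => y (j + m)] at h
  simp only [zero_add, add_assoc, add_comm 1 m] at h
  obtain ⟨l, hxl, hyl, hx, hy⟩ := exists_eq_points_of_simplexMap_eq hn hπ hnn hm h
  exact asympEquiv_of_eventually_const hlt hxl hyl
    (fun j => eq_const_of_codingMap_eq_points hn hπ hnn j hx)
    fun j => eq_const_of_codingMap_eq_points hn hπ hnn j hy

/-- The continuous bijection from the limit space onto the attractor induced by the coding map
is a homeomorphism, because the limit space is compact. -/
theorem nonempty_homeomorph_hanoiLimitSpace {n : ℕ} {E : Type*} [TopologicalSpace E] [T2Space E]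
    {π : (ℕ → Fin (n + 1)) → E} (hcont : Continuous π)
    (h : ∀ x y, π x = π y ↔ AsympEquiv (Hc (n + 1)) x y) :
    Nonempty (Set.range π ≃ₜ HanoiLimitSpace (n + 1)) := by
  let f : HanoiLimitSpace (n + 1) → Set.range π :=
    Quotient.lift (Set.rangeFactorization π) fun x y hxy => Subtype.ext ((h x y).2 hxy)
  have hf : Continuous f := (hcont.subtype_mk fun x => ⟨x, rfl⟩).quotient_lift _
  have hbij : Function.Bijective f := by
    constructor
    · rintro ⟨x⟩ ⟨y⟩ hxy
      exact Quotient.sound ((h x y).1 (congrArg Subtype.val hxy))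
    · rintro ⟨_, x, rfl⟩
      exact ⟨Quotient.mk _ x, rfl⟩
  exact ⟨(Continuous.homeoOfEquivCompactToT2 (f := Equiv.ofBijective f hbij) hf).symm⟩

theorem mainTheorem6 (k : ℕ) (hk : 3 ≤ k)
    (s : Affine.Simplex ℝ (EuclideanSpace ℝ (Fin (k - 1))) (k - 1)) (hs : s.Regular) :
    ∃ K : Set (EuclideanSpace ℝ (Fin (k - 1))),
      IsAttractor (fun i => ⇑(simplexMap s i)) K ∧
      (∀ K', IsAttractor (fun i => ⇑(simplexMap s i)) K' → K' = K) ∧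
      Nonempty (K ≃ₜ HanoiLimitSpace k) := by
  obtain ⟨n, rfl⟩ : ∃ n, k = n + 1 := ⟨k - 1, by omega⟩
  change Affine.Simplex ℝ (EuclideanSpace ℝ (Fin n)) n at s
  have hn : 2 ≤ n := by omega
  have hc := natCast_sub_one_div_lt_one hn
  have hF := lipschitzWith_simplexMap hn hs
  obtain ⟨π, hcont, hπ⟩ := exists_isCodingMap hc hF
  have hK := hπ.isAttractor_range hcont
  exact ⟨Set.range π, hK, fun K' hK' => hK'.eq hc hF hK,
    nonempty_homeomorph_hanoiLimitSpace hcont (codingMap_eq_iff_asympEquiv hn hs hcont hπ)⟩
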